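/- **Theorem 1.2.** Let $d\ge 1$, let $(\mathcal S,\mathcal B)$ be a measurable space, and let the environment $\omega=(\omega_n)_{n\in\mathbb Z}$ be a stationary ergodic sequence of $\mathcal S$-valued random variables with law $P$ on $\mathcal S^{\mathbb Z}$ (expectation $E_P$). Let $q,p_1,\dots,p_d$ be measurable maps from $\mathcal S$ to the probability measures on $\mathbb Z_+^d$. For fixed $\omega$, let $P_\omega$ (expectation $E_\omega$) be the law under which the random vectors $X_n$ and $L_{n,m}^{(i)}=(L_{n,m}^{(i,1)},\dots,L_{n,m}^{(i,d)})$ in $\mathbb Z_+^d$ ($n\ge 0$, $1\le i\le d$, $m\ge 1$) are all independent, $X_n$ with law $q(\omega_{n-1})$ and $L_{n,m}^{(i)}$ with law $p_i(\omega_n)$. The multitype branching process with immigration in the random environment is defined by $Z_0=\mathbf 0$ and $$Z_{n+1}=\sum_{i=1}^d\ \sum_{m=1}^{Z_n^{(i)}+X_n^{(i)}}L_{n,m}^{(i)},\qquad n\ge 0 ,$$ and $S_n=\sum_{k=0}^{n-1}Z_k$. The annealed law is $\mathbb P(\cdot)=E_P(P_\omega(\cdot))$. Let $I_n=I_n(\omega)$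 be the vector $E_\omega(X_n)$ and $M_n=M_n(\omega)$ the $d\times d$ matrix whose $i$-th column is the vector $E_\omega(L_{n,1}^{(i)})$ (entries in $[0,\infty]$). Let $\|\cdot\|_1$ be the $\ell^1$-norm of vectors and the corresponding operator norm of matrices, with $\log 0=-\infty$ and $\log^+x=\max\{0,\log x\}$. Assume * (A1) $E_P(\log^+\|I_0\|_1)<\infty$; * (A2) $E_P(\log^+\|M_0\|_1)<\infty$; * (A3) $\lim_{n\to\infty}n^{-1}E_P(\log\|M_{n-1}\cdots M_1M_0\|_1)<0$ (the limit, which may be $-\infty$, exists by (A2)). Then $$\mathbb P\Big(\lim_{n\to\infty}\frac{S_n}{n}=\rho\Big)=1,\qquad \rho:=\sum_{n=0}^\infty E_P(M_n\cdots M_1M_0I_0)\in[0,\infty]^d ,$$ where the limit is taken componentwise in $[0,\infty]$. -/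

import Mathlib

open MeasureTheory ProbabilityTheory Filter Topology
open scoped ENNReal

namespace MBPIRE

/-- The environment space `Ω = S^ℤ`, with the product `σ`-algebra. -/
abbrev Env (S : Type*) : Type _ := ℤ → S

/-- The left shift `(θ ω)_n = ω_{n+1}` on environments. -/
def shift {S : Type*} (ω : Env S) : Env S := fun n => ω (n + 1)

/-- Labels of the random vectors that drive the process: `Sum.inl n` is the label of the
immigration `X_n`, and `Sum.inr (n, i, m)` the label of the offspring vector `L_{n,m}^{(i)}` of the
`m`-th particle of type `i` in generation `n` (particles are numbered from `m = 0`). -/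
abbrev Label (d : ℕ) : Type := ℕ ⊕ (ℕ × Fin d × ℕ)

/-- The space `𝒯` of genealogies: a value in `ℤ_+^d` for each immigration and offspring vector. -/
abbrev Genealogy (d : ℕ) : Type := Label d → Fin d → ℕ

section Branching

variable {d : ℕ}

/-- The immigration vector `X_n`. -/
def immigration (t : Genealogy d) (n : ℕ) : Fin d → ℕ := t (Sum.inl n)

/-- The offspring vector `L_{n,m}^{(i)}`. -/
def offspring (t : Genealogy d) (n : ℕ) (i : Fin d) (m : ℕ) : Fin d → ℕ := t (Sum.inr (n, i, m))

/-- The branching process: `Z_0 = 0` and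
`Z_{n+1} = ∑_i ∑_{m = 1}^{Z_n^{(i)} + X_n^{(i)}} L_{n,m}^{(i)}`. -/
def Z (t : Genealogy d) : ℕ → Fin d → ℕ
  | 0 => 0
  | n + 1 => ∑ i : Fin d, ∑ m ∈ Finset.range (Z t n i + immigration t n i), offspring t n i m

/-- The partial sums `S_n = ∑_{k=0}^{n-1} Z_k`. -/
def partialSum (t : Genealogy d) (n : ℕ) : Fin d → ℕ := ∑ k ∈ Finset.range n, Z t k

end Branching

noncomputable section

variable {S : Type*} [MeasurableSpace S] {d : ℕ}

/-- The law of each driving vector in the environment `ω`: `X_n` has law `q(ω_{n-1})` and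
`L_{n,m}^{(i)}` has law `p_i(ω_n)`. -/
def labelLaw (q : Kernel S (Fin d → ℕ)) (p : Fin d → Kernel S (Fin d → ℕ)) (ω : Env S) :
    Label d → Measure (Fin d → ℕ)
  | Sum.inl n => q (ω ((n : ℤ) - 1))
  | Sum.inr (n, i, _) => p i (ω (n : ℤ))

instance (q : Kernel S (Fin d → ℕ)) [IsMarkovKernel q] (p : Fin d → Kernel S (Fin d → ℕ))
    [∀ i, IsMarkovKernel (p i)] (ω : Env S) (a : Label d) :
    IsProbabilityMeasure (labelLaw q p ω a) := by
  rcases a with n | ⟨n, i, m⟩ <;> simp only [labelLaw] <;> infer_instance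

theorem measurable_labelLaw (q : Kernel S (Fin d → ℕ)) (p : Fin d → Kernel S (Fin d → ℕ))
    (a : Label d) : Measurable (fun ω : Env S => labelLaw q p ω a) := by
  rcases a with n | ⟨n, i, m⟩
  · exact q.measurable.comp (measurable_pi_apply _)
  · exact (p i).measurable.comp (measurable_pi_apply _)

/-- The quenched law `P_ω`: in the environment `ω` all the vectors `X_n` and `L_{n,m}^{(i)}` are
independent, with the laws prescribed by `labelLaw`. -/
def quenched (q : Kernel S (Fin d → ℕ)) [IsMarkovKernel q] (p : Fin d → Kernel S (Fin d → ℕ))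
    [∀ i, IsMarkovKernel (p i)] : Kernel (Env S) (Genealogy d) where
  toFun ω := Measure.infinitePi (labelLaw q p ω)
  measurable' := by
    refine Measurable.measure_of_isPiSystem_of_isProbabilityMeasure
      (generateFrom_squareCylinders (α := fun _ : Label d => Fin d → ℕ)).symm
      (isPiSystem_squareCylinders (fun _ => MeasurableSpace.isPiSystem_measurableSet)
        (by simp)) ?_
    rintro _ ⟨s, t, ht, rfl⟩
    have ht' : ∀ i ∈ s, MeasurableSet (t i) := fun i _ => ht i (Set.mem_univ i)
    simp only [Measure.infinitePi_pi _ ht']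
    exact Finset.measurable_prod _ fun a ha =>
      (Measure.measurable_coe (ht' a ha)).comp (measurable_labelLaw q p a)

/-- The annealed law `ℙ(·) = E_P(P_ω(·))` on genealogies. -/
def annealed (P : Measure (Env S)) (q : Kernel S (Fin d → ℕ)) [IsMarkovKernel q]
    (p : Fin d → Kernel S (Fin d → ℕ)) [∀ i, IsMarkovKernel (p i)] : Measure (Genealogy d) :=
  P.bind (quenched q p)

/-- The vector `I_n(ω)`, with components `I_n^{(j)} = E_ω(X_n^{(j)})` in `[0, ∞]`. -/
def meanImmigration (q : Kernel S (Fin d → ℕ)) (ω : Env S) (n : ℕ) : Fin d → ℝ≥0∞ :=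
  fun j => ∫⁻ v, (v j : ℝ≥0∞) ∂(q (ω ((n : ℤ) - 1)))

/-- The matrix `M_n(ω)`, whose `i`-th column is the vector `E_ω(L_n^{(i)})`, with entries in
`[0, ∞]`. -/
def meanMatrix (p : Fin d → Kernel S (Fin d → ℕ)) (ω : Env S) (n : ℕ) :
    Matrix (Fin d) (Fin d) ℝ≥0∞ :=
  Matrix.of fun j i => ∫⁻ v, (v j : ℝ≥0∞) ∂(p i (ω (n : ℤ)))

/-- `meanProd p ω n` is the product of the `n` matrices `M_{n-1} ⋯ M_1 M_0`. -/
def meanProd (p : Fin d → Kernel S (Fin d → ℕ)) (ω : Env S) : ℕ → Matrix (Fin d) (Fin d) ℝ≥0∞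
  | 0 => 1
  | n + 1 => meanMatrix p ω n * meanProd p ω n

/-- The norm `‖v‖₁` of a vector with nonnegative components. -/
def vecNorm (v : Fin d → ℝ≥0∞) : ℝ≥0∞ := ∑ i, v i

/-- The operator norm `‖A‖₁` with respect to `‖·‖₁`. For a matrix with nonnegative entries
`‖A v‖₁ ≤ ‖A |v|‖₁`, so the supremum over the unit ball is one over nonnegative vectors. -/
def opNorm (A : Matrix (Fin d) (Fin d) ℝ≥0∞) : ℝ≥0∞ :=
  ⨆ (v : Fin d → ℝ≥0∞) (_ : vecNorm v ≤ 1), vecNorm (A.mulVec v)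

/-- `E_P(f⁺)` for an extended-real function `f`. -/
def posPartExp (P : Measure (Env S)) (f : Env S → EReal) : ℝ≥0∞ := ∫⁻ ω, (f ω).toENNReal ∂P

/-- The expectation `E_P(f) = E_P(f⁺) - E_P(f⁻)` of an extended-real function `f`, which may be
`-∞`; it is used only where `E_P(f⁺) < ∞`. -/
def extExp (P : Measure (Env S)) (f : Env S → EReal) : EReal :=
  (posPartExp P f : EReal) - (posPartExp P (fun ω => -f ω) : EReal)

/-- The standing conditions on immigration and reproduction. Here `ENNReal.log` is the logarithm
`[0, ∞] → [-∞, ∞]`, with `log 0 = -∞` and `log ∞ = ∞`. -/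
structure KeyAssumption (P : Measure (Env S)) (q : Kernel S (Fin d → ℕ))
    (p : Fin d → Kernel S (Fin d → ℕ)) : Prop where
  /-- `E_P(log⁺ ‖I_0‖₁) < ∞`. -/
  A1 : posPartExp P (fun ω => ENNReal.log (vecNorm (meanImmigration q ω 0))) < ∞
  /-- `E_P(log⁺ ‖M_0‖₁) < ∞`. -/
  A2 : posPartExp P (fun ω => ENNReal.log (opNorm (meanMatrix p ω 0))) < ∞
  /-- `lim n⁻¹ E_P(log ‖M_{n-1} ⋯ M_0‖₁) < 0`; the limit lies in `[-∞, 0)`. -/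
  A3 : ∃ l : EReal, l < 0 ∧
    Tendsto (fun n : ℕ => extExp P (fun ω => ENNReal.log (opNorm (meanProd p ω n))) / (n : EReal))
      atTop (𝓝 l)

/-- `ρ = ∑_{n ≥ 0} E_P(M_n ⋯ M_1 M_0 I_0)`, componentwise, in `[0, ∞]^d`. -/
def rho (P : Measure (Env S)) (q : Kernel S (Fin d → ℕ)) (p : Fin d → Kernel S (Fin d → ℕ)) :
    Fin d → ℝ≥0∞ :=
  fun j => ∑' n : ℕ, ∫⁻ ω, (meanProd p ω (n + 1)).mulVec (meanImmigration q ω 0) j ∂P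

end

end MBPIRE

/-!
The proof rests on a monotone coupling and on the pointwise ergodic theorem.

The next population is a monotone function of the present one when the driving vectors are kept
fixed, so the process started empty at time `1` stays below the process started empty at time `0`
(`Z_shiftGenealogy_le`). Write `sh` for the shift of genealogies by one generation, so that the
former process at time `n + 1` is `Z_n ∘ sh`. The difference `D_n = Z_{n+1} - Z_n ∘ sh ≥ 0` is the
contribution of the immigration at time `0`, and `Z_n = ∑_{l < n} D_{n-1-l} ∘ sh^l`. With
`W = ∑_n D_n` this gives, for every `k`, the two-sided bound

  `∑_{l < n} Z_k ∘ sh^l ≤ S_{n+k}`  and  `S_n ≤ ∑_{l < n} W ∘ sh^l`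

by Birkhoff sums of nonnegative functions (`birkhoffSum_le_partialSum`,
`partialSum_le_birkhoffSum`).

The annealed law is ergodic under `sh` (`ergodic_shiftGenealogy`): the section over `ω` of an
invariant set of pairs (environment, genealogy) belongs for every `n` to the `σ`-algebra of the
generations from `n` on, so it has quenched probability `0` or `1` by Kolmogorov's zero-one law, and
this probability is an invariant function of the ergodic environment. The pointwise ergodic theorem
(`Ergodic.ae_tendsto_birkhoffSum_div_lintegral`, for nonnegative functions with possibly infinite
mean) therefore sandwiches the limit points of `S_n / n` between `E Z_k` and `E W`.

The quenched means satisfy `E_ω Z_{n+1} = M_n (E_ω Z_n + I_n)`, hence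
`E_ω Z_{n+1} = E_{θω} Z_n + M_n ⋯ M_0 I_0`. By stationarity `E Z_k` is the `k`-th partial sum of
`ρ` (`lintegral_Z_annealed`), and `E W = lim E Z_k = ρ` (`lintegral_progeny`).
-/

/-! ### The pointwise ergodic theorem for ergodic maps -/

section Birkhoff

variable {α : Type*}

/-- The running maximum `max_{0 ≤ k ≤ n} ∑_{j < k} f (T^j x)` of the Birkhoff sums of `f`, defined
by the recursion `M_{n+1} = max 0 (f + M_n ∘ T)`. -/
noncomputable def birkhoffMax (T : α → α) (f : α → ℝ) : ℕ → α → ℝ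
  | 0 => fun _ => 0
  | n + 1 => fun x => max 0 (f x + birkhoffMax T f n (T x))

theorem birkhoffMax_nonneg (T : α → α) (f : α → ℝ) (n : ℕ) (x : α) : 0 ≤ birkhoffMax T f n x := by
  cases n with
  | zero => exact le_rfl
  | succ n => exact le_max_left _ _

theorem birkhoffMax_le_succ (T : α → α) (f : α → ℝ) (n : ℕ) (x : α) :
    birkhoffMax T f n x ≤ birkhoffMax T f (n + 1) x := by
  induction n generalizing x with
  | zero => exact birkhoffMax_nonneg T f 1 x
  | succ n ih => exact max_le_max le_rfl (by linarith [ih (T x)])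

theorem birkhoffMax_mono (T : α → α) (f : α → ℝ) (x : α) :
    Monotone fun n => birkhoffMax T f n x :=
  monotone_nat_of_le_succ fun n => birkhoffMax_le_succ T f n x

theorem birkhoffSum_le_birkhoffMax (T : α → α) (f : α → ℝ) (n : ℕ) (x : α) :
    birkhoffSum T f n x ≤ birkhoffMax T f n x := by
  induction n generalizing x with
  | zero => simp [birkhoffMax]
  | succ n ih =>
    rw [birkhoffSum_succ']
    exact le_max_of_le_right (by linarith [ih (T x)])

variable [MeasurableSpace α]

theorem measurable_birkhoffMax {T : α → α} (hT : Measurable T) {f : α → ℝ} (hf : Measurable f)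
    (n : ℕ) : Measurable (birkhoffMax T f n) := by
  induction n with
  | zero => exact measurable_const
  | succ n ih => exact measurable_const.max (hf.add (ih.comp hT))

variable {μ : Measure α} [IsProbabilityMeasure μ] {T : α → α}

theorem integrable_birkhoffMax (hT : MeasurePreserving T μ μ) {f : α → ℝ} (hf : Integrable f μ)
    (n : ℕ) : Integrable (birkhoffMax T f n) μ := by
  induction n with
  | zero => exact integrable_const 0
  | succ n ih =>
    exact (integrable_const (0 : ℝ)).sup (hf.add (hT.integrable_comp_of_integrable ih))

/-- If `f` has negative mean, its Birkhoff sums along an ergodic map are almost surely bounded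
above. Otherwise the running maxima `M_n` of the Birkhoff sums would tend to infinity almost surely,
so `M_{n+1} - M_n ∘ T`, whose mean is nonnegative, would tend to `f`. -/
theorem Ergodic.ae_bddAbove_birkhoffSum (hT : Ergodic T μ) {f : α → ℝ} (hfm : Measurable f)
    (hf : Integrable f μ) (hneg : ∫ x, f x ∂μ < 0) :
    ∀ᵐ x ∂μ, ∃ C, ∀ n, birkhoffSum T f n x ≤ C := by
  set A : Set α := {x | ∃ C : ℕ, ∀ n, birkhoffMax T f n x ≤ C} with hA
  have hAm : MeasurableSet A := by
    simp only [hA, Set.ofPred_exists, Set.ofPred_forall]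
    exact MeasurableSet.iUnion fun C => MeasurableSet.iInter fun n =>
      measurableSet_le (measurable_birkhoffMax hT.measurable hfm n) measurable_const
  have hAinv : T ⁻¹' A = A := by
    ext x
    simp only [hA, Set.mem_preimage, Set.mem_ofPred_eq]
    constructor
    · rintro ⟨C, hC⟩
      obtain ⟨C', hC'⟩ := exists_nat_ge (max 0 (f x + C))
      refine ⟨C', fun n => (birkhoffMax_le_succ T f n x).trans (le_trans ?_ hC')⟩
      exact max_le_max le_rfl (by linarith [hC n])
    · rintro ⟨C, hC⟩
      obtain ⟨C', hC'⟩ := exists_nat_ge ((C : ℝ) - f x)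
      refine ⟨C', fun n => ?_⟩
      have h1 : f x + birkhoffMax T f n (T x) ≤ C := (le_max_right _ _).trans (hC (n + 1))
      linarith
  rcases hT.toPreErgodic.ae_mem_or_ae_notMem hAm hAinv with h | h
  · filter_upwards [h] with x ⟨C, hC⟩
    exact ⟨C, fun n => (birkhoffSum_le_birkhoffMax T f n x).trans (hC n)⟩
  -- The maxima tend to infinity almost surely.
  · exfalso
    have hint := integrable_birkhoffMax hT.toMeasurePreserving hf
    have hlim : Tendsto
        (fun n => ∫ x, (birkhoffMax T f (n + 1) x - birkhoffMax T f n (T x)) ∂μ) atTop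
        (𝓝 (∫ x, f x ∂μ)) := by
      refine tendsto_integral_of_dominated_convergence (fun x => |f x|) (fun n => ?_) hf.abs
        (fun n => ?_) ?_
      · exact ((measurable_birkhoffMax hT.measurable hfm _).sub
          ((measurable_birkhoffMax hT.measurable hfm _).comp hT.measurable)).aestronglyMeasurable
      · refine Eventually.of_forall fun x => ?_
        have h0 := birkhoffMax_nonneg T f n (T x)
        simp only [birkhoffMax, Real.norm_eq_abs]
        rcases max_cases 0 (f x + birkhoffMax T f n (T x)) with ⟨h1, h2⟩ | ⟨h1, h2⟩ <;> rw [h1]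
        · rw [abs_le]; constructor <;> linarith [neg_abs_le (f x), abs_nonneg (f x)]
        · simp
      · filter_upwards [h] with x hx
        have hx' : T x ∉ A := fun h' => hx (hAinv ▸ h')
        simp only [hA, Set.mem_ofPred_eq, not_exists, not_forall, not_le] at hx'
        refine tendsto_const_nhds.congr' ?_
        obtain ⟨C, hC⟩ := exists_nat_ge (-f x)
        obtain ⟨n₀, hn₀⟩ := hx' C
        filter_upwards [eventually_ge_atTop n₀] with n hn
        have h1 := birkhoffMax_mono T f (T x) hn
        simp only [birkhoffMax] at h1 ⊢
        rw [max_eq_right (by linarith)]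
        ring
    have hge : ∀ n, 0 ≤ ∫ x, (birkhoffMax T f (n + 1) x - birkhoffMax T f n (T x)) ∂μ := by
      intro n
      have hcomp : ∫ x, birkhoffMax T f n (T x) ∂μ = ∫ x, birkhoffMax T f n x ∂μ := by
        have h2 := integral_map hT.measurable.aemeasurable (μ := μ) (f := birkhoffMax T f n)
          (measurable_birkhoffMax hT.measurable hfm n).aestronglyMeasurable
        rw [hT.map_eq] at h2
        exact h2.symm
      have hintT : Integrable (fun x => birkhoffMax T f n (T x)) μ :=
        hT.toMeasurePreserving.integrable_comp_of_integrable (hint n)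
      rw [integral_sub (hint (n + 1)) hintT, hcomp, sub_nonneg]
      exact integral_mono (hint n) (hint (n + 1)) (birkhoffMax_le_succ T f n)
    exact absurd (ge_of_tendsto' hlim hge) (not_le.2 hneg)

theorem Ergodic.ae_eventually_birkhoffSum_lt (hT : Ergodic T μ) {f : α → ℝ} (hfm : Measurable f)
    (hf : Integrable f μ) {c : ℝ} (hc : ∫ x, f x ∂μ < c) :
    ∀ᵐ x ∂μ, ∀ᶠ n : ℕ in atTop, birkhoffSum T f n x / n < c := by
  obtain ⟨b, hb, hbc⟩ := exists_between hc
  have hneg : ∫ x, (f x - b) ∂μ < 0 := by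
    rw [integral_sub hf (integrable_const b)]; simpa using hb
  filter_upwards [hT.ae_bddAbove_birkhoffSum (hfm.sub_const b) (hf.sub (integrable_const b)) hneg]
    with x ⟨C, hC⟩
  have hlim : Tendsto (fun n : ℕ => C / n) atTop (𝓝 0) := tendsto_const_div_atTop_nhds_zero_nat C
  filter_upwards [hlim.eventually_lt_const (sub_pos.2 hbc), eventually_gt_atTop 0] with n hn hn0
  have h1 := hC n
  have hn0' : (0 : ℝ) < n := Nat.cast_pos.2 hn0
  simp only [birkhoffSum, Finset.sum_sub_distrib, Finset.sum_const, Finset.card_range,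
    nsmul_eq_mul] at h1 ⊢
  rw [div_lt_iff₀ hn0'] at hn ⊢
  linarith

/-- The pointwise ergodic theorem for an integrable function and an ergodic map. -/
theorem Ergodic.ae_tendsto_birkhoffSum_div (hT : Ergodic T μ) {f : α → ℝ} (hfm : Measurable f)
    (hf : Integrable f μ) :
    ∀ᵐ x ∂μ, Tendsto (fun n : ℕ => birkhoffSum T f n x / n) atTop (𝓝 (∫ x, f x ∂μ)) := by
  have hup : ∀ᵐ x ∂μ, ∀ k : ℕ, ∀ᶠ n : ℕ in atTop,
      birkhoffSum T f n x / n < ∫ x, f x ∂μ + 1 / ((k : ℝ) + 1) :=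
    ae_all_iff.2 fun k => hT.ae_eventually_birkhoffSum_lt hfm hf
      (lt_add_of_pos_right _ Nat.one_div_pos_of_nat)
  have hlow : ∀ᵐ x ∂μ, ∀ k : ℕ, ∀ᶠ n : ℕ in atTop,
      birkhoffSum T (fun y => -f y) n x / n < -∫ x, f x ∂μ + 1 / ((k : ℝ) + 1) :=
    ae_all_iff.2 fun k => hT.ae_eventually_birkhoffSum_lt hfm.neg hf.neg
      (by
        simp only [Pi.neg_apply, integral_neg]
        exact lt_add_of_pos_right _ Nat.one_div_pos_of_nat)
  filter_upwards [hup, hlow] with x h1 h2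
  refine tendsto_order.2 ⟨fun a ha => ?_, fun a ha => ?_⟩
  · obtain ⟨k, hk⟩ := exists_nat_one_div_lt (sub_pos.2 ha)
    filter_upwards [h2 k] with n hn
    simp only [birkhoffSum, Finset.sum_neg_distrib, neg_div] at hn ⊢
    linarith
  · obtain ⟨k, hk⟩ := exists_nat_one_div_lt (sub_pos.2 ha)
    filter_upwards [h1 k] with n hn
    linarith

theorem Ergodic.ae_tendsto_birkhoffSum_div_of_lintegral_ne_top (hT : Ergodic T μ) {g : α → ℝ≥0∞}
    (hg : Measurable g) (hfin : ∫⁻ x, g x ∂μ ≠ ∞) :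
    ∀ᵐ x ∂μ, Tendsto (fun n : ℕ => birkhoffSum T g n x / n) atTop (𝓝 (∫⁻ x, g x ∂μ)) := by
  have hlt : ∀ᵐ x ∂μ, g x < ∞ := ae_lt_top hg hfin
  have hlt' : ∀ᵐ x ∂μ, ∀ k, g (T^[k] x) < ∞ :=
    ae_all_iff.2 fun k => (hT.iterate k).quasiMeasurePreserving.ae hlt
  filter_upwards [hlt', hT.ae_tendsto_birkhoffSum_div hg.ennreal_toReal
    (integrable_toReal_of_lintegral_ne_top hg.aemeasurable hfin)] with x hx hlim
  rw [integral_toReal hg.aemeasurable hlt] at hlim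
  have h2 := ENNReal.tendsto_ofReal hlim
  rw [ENNReal.ofReal_toReal hfin] at h2
  refine h2.congr' ?_
  filter_upwards [eventually_gt_atTop 0] with n hn
  rw [ENNReal.ofReal_div_of_pos (Nat.cast_pos.2 hn), ENNReal.ofReal_natCast]
  congr 1
  simp only [birkhoffSum]
  rw [ENNReal.ofReal_sum_of_nonneg fun _ _ => ENNReal.toReal_nonneg]
  exact Finset.sum_congr rfl fun k _ => ENNReal.ofReal_toReal (hx k).ne

/-- The pointwise ergodic theorem for a nonnegative function, whose mean may be infinite. -/
theorem Ergodic.ae_tendsto_birkhoffSum_div_lintegral (hT : Ergodic T μ) {g : α → ℝ≥0∞}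
    (hg : Measurable g) :
    ∀ᵐ x ∂μ, Tendsto (fun n : ℕ => birkhoffSum T g n x / n) atTop (𝓝 (∫⁻ x, g x ∂μ)) := by
  by_cases hfin : ∫⁻ x, g x ∂μ = ∞
  · have htrunc : Tendsto (fun k : ℕ => ∫⁻ x, min (g x) k ∂μ) atTop (𝓝 (∫⁻ x, g x ∂μ)) := by
      refine lintegral_tendsto_of_tendsto_of_monotone
        (fun k => (hg.min measurable_const).aemeasurable)
        (Eventually.of_forall fun x i j hij => ?_) (Eventually.of_forall fun x => ?_)
      · exact min_le_min le_rfl (by exact_mod_cast hij)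
      · simpa using (tendsto_const_nhds (x := g x)).min ENNReal.tendsto_nat_nhds_top
    have hlim : ∀ᵐ x ∂μ, ∀ k : ℕ, Tendsto (fun n : ℕ => birkhoffSum T (fun y => min (g y) k) n x / n)
        atTop (𝓝 (∫⁻ x, min (g x) k ∂μ)) := by
      refine ae_all_iff.2 fun k => hT.ae_tendsto_birkhoffSum_div_of_lintegral_ne_top
        (hg.min measurable_const) (ne_of_lt ?_)
      calc ∫⁻ x, min (g x) k ∂μ ≤ ∫⁻ _, (k : ℝ≥0∞) ∂μ := lintegral_mono fun x => min_le_right _ _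
        _ < ∞ := by simp
    filter_upwards [hlim] with x hx
    rw [hfin] at htrunc ⊢
    refine tendsto_order.2 ⟨fun a ha => ?_, fun a ha => absurd ha not_top_lt⟩
    obtain ⟨k, hk⟩ := (htrunc.eventually_const_lt ha).exists
    filter_upwards [(hx k).eventually_const_lt hk] with n hn
    refine hn.trans_le (ENNReal.div_le_div_right (Finset.sum_le_sum fun i _ => min_le_left _ _) _)
  · exact hT.ae_tendsto_birkhoffSum_div_of_lintegral_ne_top hg hfin

end Birkhoff

namespace MBPIRE

variable {d : ℕ}

/-! ### Monotonicity of the branching process in its starting time -/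

/-- The label of the vector with the same role one generation later. -/
def Label.succ : Label d → Label d
  | Sum.inl n => Sum.inl (n + 1)
  | Sum.inr (n, i, m) => Sum.inr (n + 1, i, m)

/-- The shift of genealogies by one generation, which forgets generation `0`. -/
def shiftGenealogy (t : Genealogy d) : Genealogy d := fun a => t a.succ

theorem measurable_shiftGenealogy : Measurable (shiftGenealogy (d := d)) :=
  measurable_pi_iff.2 fun a => measurable_pi_apply a.succ

/-- The process started with no particles at time `1` stays below the one started with no particles
at time `0` when both use the same driving vectors. -/
theorem Z_shiftGenealogy_le (t : Genealogy d) (n : ℕ) : Z (shiftGenealogy t) n ≤ Z t (n + 1) := by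
  induction n with
  | zero => exact fun _ => Nat.zero_le _
  | succ n ih =>
    rw [Z, Z]
    refine Finset.sum_le_sum fun i _ => ?_
    refine Finset.sum_le_sum_of_subset_of_nonneg (Finset.range_mono ?_) fun m _ _ _ => Nat.zero_le _
    exact Nat.add_le_add_right (ih i) _

theorem Z_iterate_shiftGenealogy_le (t : Genealogy d) (n k : ℕ) :
    Z (shiftGenealogy^[k] t) n ≤ Z t (n + k) := by
  induction k generalizing t with
  | zero => exact le_rfl
  | succ k ih => exact (ih (shiftGenealogy t)).trans (Z_shiftGenealogy_le t (n + k))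

/-- The number of type `i` particles at time `n + 1` which are due to the immigration at time `0`,
as the increment of the process when its starting time goes from `1` to `0`. -/
def increment (t : Genealogy d) (i : Fin d) (n : ℕ) : ℕ := Z t (n + 1) i - Z (shiftGenealogy t) n i

theorem increment_add (t : Genealogy d) (i : Fin d) (n : ℕ) :
    increment t i n + Z (shiftGenealogy t) n i = Z t (n + 1) i :=
  Nat.sub_add_cancel (Z_shiftGenealogy_le t n i)

/-- The total progeny of type `i` due to the immigration at time `0`. -/
noncomputable def progeny (t : Genealogy d) (i : Fin d) : ℝ≥0∞ := ∑' n, (increment t i n : ℝ≥0∞)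

theorem partialSum_apply (t : Genealogy d) (n : ℕ) (i : Fin d) :
    partialSum t n i = ∑ k ∈ Finset.range n, Z t k i := by
  simp [partialSum]

theorem partialSum_le_birkhoffSum (t : Genealogy d) (n : ℕ) (i : Fin d) :
    (partialSum t n i : ℝ≥0∞) ≤ birkhoffSum shiftGenealogy (fun s => progeny s i) n t := by
  induction n generalizing t with
  | zero => simp [partialSum]
  | succ n ih =>
    have hsplit : partialSum t (n + 1) i
        = ∑ k ∈ Finset.range n, increment t i k + partialSum (shiftGenealogy t) n i := by
      simp only [partialSum_apply]
      rw [Finset.sum_range_succ', ← Finset.sum_add_distrib]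
      simp [increment_add, Z]
    rw [birkhoffSum_succ', hsplit]
    push_cast
    exact add_le_add (ENNReal.sum_le_tsum _) (ih _)

theorem birkhoffSum_le_partialSum (t : Genealogy d) (n k : ℕ) (i : Fin d) :
    birkhoffSum shiftGenealogy (fun s => (Z s k i : ℝ≥0∞)) n t ≤ partialSum t (n + k) i := by
  rw [partialSum_apply, Nat.cast_sum, add_comm, Finset.sum_range_add]
  refine le_add_left (Finset.sum_le_sum fun l _ => ?_)
  exact Nat.cast_le.2 (Z_iterate_shiftGenealogy_le t k l i)

/-! ### Measurability in the driving vectors -/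

theorem measurable_sum_range {Ω M : Type*} [MeasurableSpace Ω] [MeasurableSpace M]
    [AddCommMonoid M] [MeasurableAdd₂ M] {N : Ω → ℕ} (hN : Measurable N) {L : ℕ → Ω → M}
    (hL : ∀ m, Measurable (L m)) : Measurable fun x => ∑ m ∈ Finset.range (N x), L m x := by
  have h : Measurable fun y : ℕ × Ω => ∑ m ∈ Finset.range y.1, L m y.2 :=
    measurable_from_prod_countable_right fun n =>
      Finset.measurable_fun_sum (Finset.range n) fun m _ => hL m
  exact h.comp (hN.prodMk measurable_id)

/-- The time at which a driving vector is used. -/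
def Label.time : Label d → ℕ
  | Sum.inl n => n
  | Sum.inr (n, _, _) => n

/-- `Z_n` only depends on the driving vectors of the generations before `n`. -/
theorem measurable_Z_of_lt {m : MeasurableSpace (Genealogy d)} {n : ℕ}
    (h : ∀ a : Label d, a.time < n → Measurable[m] fun t : Genealogy d => t a) :
    Measurable[m] fun t : Genealogy d => Z t n := by
  induction n with
  | zero => exact measurable_const
  | succ n ih =>
    have ih' := ih fun a ha => h a (ha.trans n.lt_succ_self)
    simp only [Z]
    refine Finset.measurable_fun_sum _ fun i _ => measurable_sum_range ?_ fun l => ?_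
    · exact ((measurable_pi_apply i).comp ih').add
        ((measurable_pi_apply i).comp (h (Sum.inl n) n.lt_succ_self))
    · exact h (Sum.inr (n, i, l)) n.lt_succ_self

theorem measurable_Z (n : ℕ) : Measurable fun t : Genealogy d => Z t n :=
  measurable_Z_of_lt fun a _ => measurable_pi_apply a

theorem measurable_Z_apply (n : ℕ) (i : Fin d) :
    Measurable fun t : Genealogy d => (Z t n i : ℝ≥0∞) :=
  measurable_from_top.comp ((measurable_pi_apply i).comp (measurable_Z n))

theorem measurable_increment (n : ℕ) (i : Fin d) :
    Measurable fun t : Genealogy d => (increment t i n : ℝ≥0∞) :=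
  measurable_from_top.comp (((measurable_pi_apply i).comp (measurable_Z (n + 1))).sub
    ((measurable_pi_apply i).comp ((measurable_Z n).comp measurable_shiftGenealogy)))

theorem measurable_progeny (i : Fin d) : Measurable fun t : Genealogy d => progeny t i :=
  Measurable.tsum fun n => measurable_increment n i

/-! ### Ergodicity of the annealed law -/

variable {S : Type*} [MeasurableSpace S]
  (q : Kernel S (Fin d → ℕ)) [IsMarkovKernel q]
  (p : Fin d → Kernel S (Fin d → ℕ)) [∀ i, IsMarkovKernel (p i)]

instance : IsMarkovKernel (quenched q p) :=
  ⟨fun ω => inferInstanceAs (IsProbabilityMeasure (Measure.infinitePi (labelLaw q p ω)))⟩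

theorem quenched_apply (ω : Env S) : quenched q p ω = Measure.infinitePi (labelLaw q p ω) := rfl

theorem Label.succ_injective : Function.Injective (Label.succ (d := d)) := by
  rintro (n | ⟨n, i, m⟩) (n' | ⟨n', i', m'⟩) h <;> simp_all [Label.succ]

omit [IsMarkovKernel q] [∀ i, IsMarkovKernel (p i)] in
theorem labelLaw_shift (ω : Env S) (a : Label d) :
    labelLaw q p (shift ω) a = labelLaw q p ω a.succ := by
  rcases a with n | ⟨n, i, m⟩ <;> simp [labelLaw, Label.succ, shift]

theorem quenched_shift (ω : Env S) :
    quenched q p (shift ω) = (quenched q p ω).map shiftGenealogy := by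
  rw [quenched_apply, quenched_apply]
  have h : labelLaw q p (shift ω) = fun a => labelLaw q p ω a.succ :=
    funext (labelLaw_shift q p ω)
  simp only [h]
  exact (Measure.map_infinitePi_infinitePi_of_inj (P := labelLaw q p ω)
    Label.succ_injective).symm

theorem iIndep_comap_eval (ω : Env S) :
    iIndep (fun a : Label d => MeasurableSpace.comap (fun t : Genealogy d => t a) inferInstance)
      (quenched q p ω) :=
  iIndepFun_infinitePi (P := labelLaw q p ω) (X := fun _ v => v) fun _ => measurable_id

theorem Label.time_iterate_succ (a : Label d) (n : ℕ) : (Label.succ^[n] a).time = a.time + n := by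
  induction n generalizing a with
  | zero => rfl
  | succ n ih =>
    rw [Function.iterate_succ_apply, ih]
    rcases a with k | ⟨k, i, m⟩ <;> simp only [Label.succ, Label.time] <;> omega

theorem iterate_shiftGenealogy_apply (t : Genealogy d) (n : ℕ) (a : Label d) :
    shiftGenealogy^[n] t a = t (Label.succ^[n] a) := by
  induction n generalizing t with
  | zero => rfl
  | succ n ih =>
    rw [Function.iterate_succ_apply, ih, Function.iterate_succ_apply']
    rfl

/-- In a fixed environment, a set of genealogies which for every `n` is determined by the driving
vectors of the generations from `n` on is trivial. -/
theorem quenched_eq_zero_or_one (ω : Env S) {A : Set (Genealogy d)}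
    (hA : ∀ n, ∃ B, MeasurableSet B ∧ A = shiftGenealogy^[n] ⁻¹' B) :
    quenched q p ω A = 0 ∨ quenched q p ω A = 1 := by
  refine measure_zero_or_one_of_measurableSet_limsup (f := atTop.comap (Label.time (d := d)))
    (p := fun s : Set (Label d) => ∃ n, ∀ a ∈ s, a.time ≤ n) (ns := fun n => {a | a.time ≤ n})
    (fun a => (measurable_pi_apply a).comap_le) (iIndep_comap_eval q p ω) ?_ ?_
    (fun n => ⟨n, fun _ h => h⟩) (fun a => ⟨a.time, le_refl a.time⟩) ?_
  · rintro s ⟨n, hn⟩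
    exact ⟨Set.Ioi n, Ioi_mem_atTop n, fun a ha has => not_lt.2 (hn a has) ha⟩
  · exact (show Monotone fun n : ℕ => {a : Label d | a.time ≤ n} from
      fun _ _ h _ ha => le_trans ha h).directed_le
  · rw [((atTop_basis (α := ℕ)).comap (Label.time (d := d))).limsup_eq_iInf_iSup]
    simp only [MeasurableSpace.measurableSet_iInf]
    intro n _
    obtain ⟨B, hB, rfl⟩ := hA n
    set future : MeasurableSpace (Genealogy d) :=
      ⨆ a ∈ Label.time ⁻¹' Set.Ici n, MeasurableSpace.comap (fun t : Genealogy d => t a) inferInstance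
    suffices h : @Measurable _ _ future MeasurableSpace.pi (shiftGenealogy (d := d))^[n] from h hB
    refine (@measurable_pi_iff _ _ _ future _ _).2 fun a => ?_
    simp only [iterate_shiftGenealogy_apply]
    refine Measurable.mono (comap_measurable _) ?_ le_rfl
    refine le_iSup₂_of_le (Label.succ^[n] a) ?_ le_rfl
    simp [Label.time_iterate_succ]

/-- The shift of the environment together with the genealogy. -/
def jointShift (x : Env S × Genealogy d) : Env S × Genealogy d := (shift x.1, shiftGenealogy x.2)

theorem measurable_shift : Measurable (shift (S := S)) :=
  measurable_pi_iff.2 fun n => measurable_pi_apply (n + 1)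

theorem measurable_jointShift : Measurable (jointShift (S := S) (d := d)) :=
  (measurable_shift.comp measurable_fst).prodMk (measurable_shiftGenealogy.comp measurable_snd)

omit [MeasurableSpace S] in
theorem iterate_jointShift (x : Env S × Genealogy d) (n : ℕ) :
    jointShift^[n] x = (shift^[n] x.1, shiftGenealogy^[n] x.2) := by
  induction n generalizing x with
  | zero => rfl
  | succ n ih => rw [Function.iterate_succ_apply, ih]; rfl

variable {P : Measure (Env S)} [IsProbabilityMeasure P]

theorem measurePreserving_jointShift (hP : MeasurePreserving shift P P) :
    MeasurePreserving jointShift (P ⊗ₘ quenched q p) (P ⊗ₘ quenched q p) := by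
  refine ⟨measurable_jointShift, Measure.ext fun s hs => ?_⟩
  rw [Measure.map_apply measurable_jointShift hs, Measure.compProd_apply hs,
    Measure.compProd_apply (measurable_jointShift hs),
    ← hP.lintegral_comp (Kernel.measurable_kernel_prodMk_left hs)]
  refine lintegral_congr fun ω => ?_
  rw [quenched_shift, Measure.map_apply measurable_shiftGenealogy (measurable_prodMk_left hs)]
  rfl

/-- The environment together with the genealogy is ergodic. A section of an invariant set is
trivial by Kolmogorov's zero-one law, and its probability is a shift invariant function of the
environment. -/
theorem ergodic_jointShift (hP : Ergodic shift P) :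
    Ergodic jointShift (P ⊗ₘ quenched q p) := by
  refine ⟨measurePreserving_jointShift q p hP.toMeasurePreserving, ⟨fun s hs hinv => ?_⟩⟩
  have h01 : ∀ ω, quenched q p ω (Prod.mk ω ⁻¹' s) = 0 ∨ quenched q p ω (Prod.mk ω ⁻¹' s) = 1 := by
    refine fun ω => quenched_eq_zero_or_one q p ω fun n =>
      ⟨Prod.mk (shift^[n] ω) ⁻¹' s, measurable_prodMk_left hs, ?_⟩
    have hn : jointShift^[n] ⁻¹' s = s := Function.IsFixedPt.preimage_iterate hinv n
    calc Prod.mk ω ⁻¹' s = Prod.mk ω ⁻¹' (jointShift^[n] ⁻¹' s) := by rw [hn]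
      _ = _ := by ext t; simp only [Set.mem_preimage, iterate_jointShift]
  have hm : Measurable fun ω => quenched q p ω (Prod.mk ω ⁻¹' s) :=
    Kernel.measurable_kernel_prodMk_left hs
  have hshift : shift ⁻¹' {ω | quenched q p ω (Prod.mk ω ⁻¹' s) = 1}
      = {ω | quenched q p ω (Prod.mk ω ⁻¹' s) = 1} := by
    ext ω
    simp only [Set.mem_preimage, Set.mem_ofPred_eq]
    rw [quenched_shift, Measure.map_apply measurable_shiftGenealogy (measurable_prodMk_left hs)]
    have : shiftGenealogy ⁻¹' (Prod.mk (shift ω) ⁻¹' s) = Prod.mk ω ⁻¹' s := by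
      conv_rhs => rw [← hinv]
      rfl
    rw [this]
  rw [eventuallyConst_set]
  refine (hP.toPreErgodic.ae_mem_or_ae_notMem
    (hm (measurableSet_singleton 1)) hshift).imp (fun h => ?_) fun h => ?_
  · refine (Measure.ae_compProd_iff hs).2 ?_
    filter_upwards [h] with ω hω
    exact (prob_compl_eq_zero_iff (measurable_prodMk_left hs)).2 hω
  · refine (Measure.ae_compProd_iff hs.compl).2 ?_
    filter_upwards [h] with ω hω
    exact measure_eq_zero_iff_ae_notMem.1 ((h01 ω).resolve_right hω)

theorem annealed_eq_snd : annealed P q p = (P ⊗ₘ quenched q p).snd :=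
  (Measure.snd_compProd P (quenched q p)).symm

instance : IsProbabilityMeasure (annealed P q p) := by
  rw [annealed_eq_snd]; infer_instance

theorem ergodic_shiftGenealogy (hP : Ergodic shift P) :
    Ergodic shiftGenealogy (annealed P q p) := by
  have hsnd : MeasurePreserving Prod.snd (P ⊗ₘ quenched q p) (annealed P q p) :=
    ⟨measurable_snd, (annealed_eq_snd q p).symm⟩
  exact hsnd.ergodic_of_ergodic_semiconj (ergodic_jointShift q p hP) measurable_shiftGenealogy
    fun _ => rfl

/-! ### Means of the branching process -/

/-- Wald's identity for a random number of summands, each independent of that number. -/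
theorem lintegral_sum_range_of_indepFun {Ω : Type*} [MeasurableSpace Ω] {μ : Measure Ω}
    {N : Ω → ℕ} (hN : Measurable N) {L : ℕ → Ω → ℝ≥0∞} (hL : ∀ m, Measurable (L m))
    (hind : ∀ m, IndepFun N (L m) μ) {c : ℝ≥0∞} (hc : ∀ m, ∫⁻ x, L m x ∂μ = c) :
    ∫⁻ x, ∑ m ∈ Finset.range (N x), L m x ∂μ = (∫⁻ x, (N x : ℝ≥0∞) ∂μ) * c := by
  -- Write both sides as series over `m` with the weights `1_{m < N}`.
  set b : ℕ → ℕ → ℝ≥0∞ := fun m k => if m < k then 1 else 0 with hb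
  have hbm : ∀ m, Measurable fun x => b m (N x) := fun m =>
    (measurable_from_top (f := b m)).comp hN
  have hsum : ∀ (k : ℕ) (v : ℕ → ℝ≥0∞), ∑ m ∈ Finset.range k, v m = ∑' m, b m k * v m := by
    intro k v
    rw [tsum_eq_sum (s := Finset.range k) fun m hm => by simp_all]
    exact Finset.sum_congr rfl fun m hm => by simp [hb, Finset.mem_range.1 hm]
  have hN' : ∀ x, (N x : ℝ≥0∞) = ∑' m, b m (N x) := fun x => by
    simpa using hsum (N x) fun _ => 1
  simp_rw [hN', hsum]
  have hprod : ∀ m, AEMeasurable (fun x => b m (N x) * L m x) μ := fun m =>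
    ((hbm m).mul (hL m)).aemeasurable
  rw [lintegral_tsum hprod,
    lintegral_tsum fun m => (hbm m).aemeasurable, ← ENNReal.tsum_mul_right]
  refine tsum_congr fun m => ?_
  rw [← hc m]
  exact lintegral_mul_eq_lintegral_mul_lintegral_of_indepFun (hbm m) (hL m)
    ((hind m).comp (φ := b m) (ψ := id) measurable_from_top measurable_id)

/-- The quenched mean `E_ω(Z_n)`. -/
noncomputable def quenchedMean (ω : Env S) (n : ℕ) : Fin d → ℝ≥0∞ :=
  fun j => ∫⁻ t, (Z t n j : ℝ≥0∞) ∂(quenched q p ω)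

theorem measurable_cast_apply (j : Fin d) : Measurable fun v : Fin d → ℕ => (v j : ℝ≥0∞) :=
  measurable_from_top.comp (measurable_pi_apply j)

theorem lintegral_label (ω : Env S) (a : Label d) (j : Fin d) :
    ∫⁻ t, (t a j : ℝ≥0∞) ∂(quenched q p ω) = ∫⁻ v, (v j : ℝ≥0∞) ∂(labelLaw q p ω a) := by
  rw [← Measure.infinitePi_map_eval (labelLaw q p ω) a,
    lintegral_map (measurable_cast_apply j) (measurable_pi_apply a)]
  rfl

/-- The particles which reproduce in generation `n` are independent of each offspring vector of that
generation. -/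
theorem indepFun_parents_offspring (ω : Env S) (n : ℕ) (i : Fin d) (m : ℕ) :
    IndepFun (fun t : Genealogy d => Z t n i + immigration t n i)
      (fun t : Genealogy d => offspring t n i m) (quenched q p ω) := by
  have hdisj : Disjoint ({a : Label d | a.time < n} ∪ {Sum.inl n}) {Sum.inr (n, i, m)} := by
    simp [Label.time]
  have hind := indep_iSup_of_disjoint
    (fun a : Label d => (measurable_pi_apply a : Measurable fun t : Genealogy d => t a).comap_le)
    (iIndep_comap_eval q p ω) hdisj
  rw [IndepFun_iff_Indep]
  refine indep_of_indep_of_le_left (indep_of_indep_of_le_right hind ?_) ?_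
  · exact le_iSup₂_of_le (Sum.inr (n, i, m)) rfl le_rfl
  · set past : MeasurableSpace (Genealogy d) :=
      ⨆ a ∈ {a : Label d | a.time < n} ∪ {Sum.inl n},
        MeasurableSpace.comap (fun t : Genealogy d => t a) inferInstance with hpast
    have hmeas : ∀ a ∈ {a : Label d | a.time < n} ∪ {Sum.inl n},
        Measurable[past] fun t : Genealogy d => t a := fun a ha =>
      (comap_measurable _).mono (le_iSup₂_of_le a ha le_rfl) le_rfl
    have hZ : Measurable[past] fun t : Genealogy d => Z t n :=
      measurable_Z_of_lt fun a ha => hmeas a (Or.inl ha)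
    have hZi : Measurable[past] fun t : Genealogy d => Z t n i := (measurable_pi_apply i).comp hZ
    have hXi : Measurable[past] fun t : Genealogy d => immigration t n i :=
      (measurable_pi_apply i).comp (hmeas (Sum.inl n) (Or.inr rfl))
    exact Measurable.comap_le (hZi.add hXi)

theorem quenchedMean_zero (ω : Env S) : quenchedMean q p ω 0 = 0 := by
  funext j
  simp [quenchedMean, Z]

theorem quenchedMean_succ (ω : Env S) (n : ℕ) :
    quenchedMean q p ω (n + 1)
      = (meanMatrix p ω n).mulVec (quenchedMean q p ω n + meanImmigration q ω n) := by
  funext j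
  have hN : ∀ i, Measurable fun t : Genealogy d => Z t n i + immigration t n i := fun i =>
    ((measurable_pi_apply i).comp (measurable_Z n)).add
      ((measurable_pi_apply i).comp (measurable_pi_apply (Sum.inl n)))
  have hL : ∀ i m, Measurable fun t : Genealogy d => (offspring t n i m j : ℝ≥0∞) := fun i m =>
    (measurable_cast_apply j).comp (measurable_pi_apply (Sum.inr (n, i, m)))
  have hZ : ∀ t : Genealogy d, (Z t (n + 1) j : ℝ≥0∞)
      = ∑ i, ∑ m ∈ Finset.range (Z t n i + immigration t n i), (offspring t n i m j : ℝ≥0∞) := by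
    intro t
    simp [Z]
  simp only [quenchedMean, hZ]
  rw [lintegral_finsetSum _ fun i _ => measurable_sum_range (hN i) (hL i)]
  simp only [Matrix.mulVec, dotProduct]
  refine Finset.sum_congr rfl fun i _ => ?_
  have hmean : ∀ m, ∫⁻ t, (offspring t n i m j : ℝ≥0∞) ∂(quenched q p ω) = meanMatrix p ω n j i :=
    fun m => lintegral_label q p ω (Sum.inr (n, i, m)) j
  rw [lintegral_sum_range_of_indepFun (hN i) (hL i)
    (fun m => (indepFun_parents_offspring q p ω n i m).comp measurable_id (measurable_cast_apply j))
    hmean, mul_comm]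
  congr 1
  simp only [Nat.cast_add]
  rw [lintegral_add_left (measurable_Z_apply n i)]
  exact congrArg _ (lintegral_label q p ω (Sum.inl n) i)

omit [IsMarkovKernel q] in
theorem meanImmigration_shift (ω : Env S) (n : ℕ) :
    meanImmigration q (shift ω) n = meanImmigration q ω (n + 1) := by
  funext j
  simp [meanImmigration, shift]

omit [∀ i, IsMarkovKernel (p i)] in
theorem meanMatrix_shift (ω : Env S) (n : ℕ) :
    meanMatrix p (shift ω) n = meanMatrix p ω (n + 1) := by
  simp [meanMatrix, shift]

/-- The mean of `Z_{n+1}` splits into the part due to the immigration at times `≥ 1` and the one due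
to the immigration at time `0`. -/
theorem quenchedMean_succ_eq_shift (ω : Env S) (n : ℕ) :
    quenchedMean q p ω (n + 1) = quenchedMean q p (shift ω) n
      + (meanProd p ω (n + 1)).mulVec (meanImmigration q ω 0) := by
  induction n with
  | zero => simp [quenchedMean_succ, quenchedMean_zero, meanProd]
  | succ n ih =>
    rw [quenchedMean_succ, ih, quenchedMean_succ, meanImmigration_shift, meanMatrix_shift,
      add_right_comm, Matrix.mulVec_add, Matrix.mulVec_mulVec]
    rfl

omit [IsProbabilityMeasure P] in
theorem lintegral_annealed {f : Genealogy d → ℝ≥0∞} (hf : Measurable f) :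
    ∫⁻ t, f t ∂(annealed P q p) = ∫⁻ ω, ∫⁻ t, f t ∂(quenched q p ω) ∂P :=
  Measure.lintegral_bind (quenched q p).aemeasurable hf.aemeasurable

/-- The annealed mean of `Z_n` is a partial sum of `ρ`. -/
theorem lintegral_Z_annealed (hP : MeasurePreserving shift P P) (n : ℕ) (i : Fin d) :
    ∫⁻ t, (Z t n i : ℝ≥0∞) ∂(annealed P q p)
      = ∑ k ∈ Finset.range n,
          ∫⁻ ω, (meanProd p ω (k + 1)).mulVec (meanImmigration q ω 0) i ∂P := by
  rw [lintegral_annealed q p (measurable_Z_apply n i)]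
  change ∫⁻ ω, quenchedMean q p ω n i ∂P = _
  have hm : ∀ n, Measurable fun ω => quenchedMean q p ω n i := fun n =>
    (measurable_Z_apply n i).lintegral_kernel
  induction n with
  | zero => simp [quenchedMean_zero]
  | succ n ih =>
    simp only [quenchedMean_succ_eq_shift, Pi.add_apply]
    have hms : Measurable fun ω => quenchedMean q p (shift ω) n i := (hm n).comp measurable_shift
    rw [lintegral_add_left hms, hP.lintegral_comp (hm n), ih,
      Finset.sum_range_succ]

/-- The mean total progeny of the immigrants of one generation is `ρ`. -/
theorem lintegral_progeny (hP : Ergodic shift P) (i : Fin d) :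
    ∫⁻ t, progeny t i ∂(annealed P q p) = rho P q p i := by
  have hsum : ∀ n, ∑ k ∈ Finset.range n, ∫⁻ t, (increment t i k : ℝ≥0∞) ∂(annealed P q p)
      = ∫⁻ t, (Z t n i : ℝ≥0∞) ∂(annealed P q p) := by
    intro n
    induction n with
    | zero => simp [Z]
    | succ n ih =>
      rw [Finset.sum_range_succ, ih]
      simp only [← increment_add, Nat.cast_add]
      rw [lintegral_add_left (measurable_increment n i), add_comm,
        (ergodic_shiftGenealogy q p hP).toMeasurePreserving.lintegral_comp (measurable_Z_apply n i)]
  simp only [progeny]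
  rw [lintegral_tsum fun n => (measurable_increment n i).aemeasurable]
  refine tendsto_nhds_unique (ENNReal.tendsto_nat_tsum _) ?_
  simp only [hsum, lintegral_Z_annealed q p hP.toMeasurePreserving]
  exact ENNReal.tendsto_nat_tsum _

end MBPIRE

/-! ### The strong law for the partial sums -/

theorem theorem1p2 {S : Type*} [MeasurableSpace S] (d : ℕ) (hd : 1 ≤ d)
    (P : Measure (MBPIRE.Env S)) [IsProbabilityMeasure P] (hP : Ergodic MBPIRE.shift P)
    (q : Kernel S (Fin d → ℕ)) [IsMarkovKernel q]
    (p : Fin d → Kernel S (Fin d → ℕ)) [∀ i, IsMarkovKernel (p i)]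
    (hKey : MBPIRE.KeyAssumption P q p) :
    ∀ᵐ t ∂(MBPIRE.annealed P q p),
      Tendsto (fun (n : ℕ) (i : Fin d) => (MBPIRE.partialSum t n i : ℝ≥0∞) / (n : ℝ≥0∞))
        atTop (𝓝 (MBPIRE.rho P q p)) := by
  have hT := MBPIRE.ergodic_shiftGenealogy q p hP
  have hup := ae_all_iff.2 fun i =>
    hT.ae_tendsto_birkhoffSum_div_lintegral (MBPIRE.measurable_progeny i)
  have hlow := ae_all_iff.2 fun i => ae_all_iff.2 fun k =>
    hT.ae_tendsto_birkhoffSum_div_lintegral (MBPIRE.measurable_Z_apply k i)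
  filter_upwards [hup, hlow] with t hup hlow
  refine tendsto_pi_nhds.2 fun i => tendsto_order.2 ⟨fun c hc => ?_, fun c hc => ?_⟩
  -- Lower bound: `c < E Z_k` for some `k`, and `S_{n+k}` exceeds the `n`-th Birkhoff sum of `Z_k`;
  -- the factor `n / (n + k)` accounts for the change of the denominator.
  · have hmean : Tendsto (fun k => ∫⁻ t, (MBPIRE.Z t k i : ℝ≥0∞) ∂(MBPIRE.annealed P q p)) atTop
        (𝓝 (MBPIRE.rho P q p i)) := by
      simp only [MBPIRE.lintegral_Z_annealed q p hP.toMeasurePreserving]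
      exact ENNReal.tendsto_nat_tsum _
    obtain ⟨k, hk⟩ := (hmean.eventually_const_lt hc).exists
    have hratio : Tendsto (fun n : ℕ => (n : ℝ≥0∞) / ((n + k : ℕ) : ℝ≥0∞)) atTop (𝓝 1) := by
      have h := ENNReal.tendsto_ofReal (tendsto_natCast_div_add_atTop (k : ℝ))
      rw [ENNReal.ofReal_one] at h
      refine h.congr' ?_
      filter_upwards [eventually_gt_atTop 0] with n hn
      have hpos : (0 : ℝ) < n + k := by positivity
      rw [ENNReal.ofReal_div_of_pos hpos, ← Nat.cast_add, ENNReal.ofReal_natCast,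
        ENNReal.ofReal_natCast]
    have hprod := ENNReal.Tendsto.mul (hlow i k) (Or.inr ENNReal.one_ne_top) hratio
      (Or.inl one_ne_zero)
    rw [mul_one] at hprod
    rw [← map_add_atTop_eq_nat k, eventually_map]
    filter_upwards [hprod.eventually_const_lt hk, eventually_gt_atTop 0] with n hn hn0
    refine hn.trans_le (le_trans (le_of_eq ?_)
      (ENNReal.div_le_div_right (MBPIRE.birkhoffSum_le_partialSum t n k i) _))
    have hn0' : (n : ℝ≥0∞) ≠ 0 := by exact_mod_cast hn0.ne'
    rw [← mul_div_assoc, ENNReal.div_mul_cancel hn0' (ENNReal.natCast_ne_top n)]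
  -- Upper bound: `S_n` is at most the `n`-th Birkhoff sum of `progeny`, whose mean is `ρ`.
  · rw [← MBPIRE.lintegral_progeny q p hP i] at hc
    filter_upwards [(hup i).eventually_lt_const hc] with n hn
    exact (ENNReal.div_le_div_right (MBPIRE.partialSum_le_birkhoffSum t n i) _).trans_lt hn
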